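/- Let $T>0$, let $(\Omega,\mathcal F,(\mathcal F_t)_{t\in[0,T]},\mathbb P)$ be a filtered probability space whose filtration is right-continuous and complete (every $\mathcal F_t$ contains all $\mathbb P$-null sets), and let $S=(S_t)_{t\in[0,T]}$ be an adapted right-continuous process with values in $\mathbb R^d_+$. For $t\in[0,T]$ let $\mathcal V_{t,T}$ be the set of all random variables $$\sum_{i=1}^n \theta_{\tau_{i-1}}\cdot(S_{\tau_i}-S_{\tau_{i-1}}),$$ where $n\ge 1$, $t=\tau_0\le\tau_1\le\dots\le\tau_n=T$ are stopping times, and each $\theta_{\tau_i}$ is an $\mathcal F_{\tau_i}$-measurable $\mathbb R^d$-valued random variable. Let $\mathcal P_{t,T}$ be the set of super-hedging prices of the zero claim at time $t$, i.e. of all $\mathcal F_t$-measurable real random variables $p$ such that $p+V\ge 0$ a.s. for some $V\in\mathcal V_{t,T}$. The condition AIP (absence of instantaneous profit) holds in discrete time if, for every $t\in[0,T]$, the only $p\in\mathcal P_{t,T}$ with $p\le 0$ a.s. is $p=0$ (a.s.). For a sub-$\sigma$-algebra $\mathcal H$ of $\mathcal F$ and an $\mathbb R^d$-valued random variable $X$,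 let $\operatorname{supp}_{\mathcal H}(X)$ be the $\mathcal H$-conditional support of $X$, i.e. the smallest (up to null sets) $\mathcal H$-measurable random closed set that contains $X$ a.s.; and for $A\subseteq\mathbb R^d$ let $\overline{\operatorname{conv}}(A)$ be the closed convex hull of $A$. **Proposition.** AIP holds in discrete time if and only if, for all $[0,T]$-valued stopping times $\tau_1\le\tau_2$, $$S_{\tau_1}\in\overline{\operatorname{conv}}\bigl(\operatorname{supp}_{\mathcal F_{\tau_1}}(S_{\tau_2})\bigr)\quad\text{a.s.}$$ -/

import Mathlib

open MeasureTheory ProbabilityTheory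

noncomputable section

namespace AIPModel

/-! ### Conditional support -/

/-- `Γ` is a closed random set of `E`, measurable with respect to the σ-algebra `m`
(Effros measurability: every event "`Γ` hits the open set `U`" belongs to `m`). -/
structure IsClosedRandomSet {Ω E : Type*} [TopologicalSpace E] (m : MeasurableSpace Ω)
    (Γ : Ω → Set E) : Prop where
  isClosed : ∀ ω, IsClosed (Γ ω)
  measurable : ∀ U : Set E, IsOpen U → MeasurableSet[m] {ω | (Γ ω ∩ U).Nonempty}

/-- `Γ` is (a version of) the `m`-conditional support of `X`: the smallest, up to null sets,
closed `m`-measurable random set that contains `X` almost surely. -/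
structure IsCondSupport {Ω E : Type*} [TopologicalSpace E] (m : MeasurableSpace Ω)
    {m0 : MeasurableSpace Ω} (μ : Measure Ω) (X : Ω → E) (Γ : Ω → Set E) : Prop where
  isClosedRandomSet : IsClosedRandomSet m Γ
  ae_mem : ∀ᵐ ω ∂μ, X ω ∈ Γ ω
  ae_subset : ∀ Γ' : Ω → Set E, IsClosedRandomSet m Γ' → (∀ᵐ ω ∂μ, X ω ∈ Γ' ω) →
    ∀ᵐ ω ∂μ, Γ ω ⊆ Γ' ω

/-- The conditional support exists for every random vector. -/
theorem exists_isCondSupport {Ω E : Type*} [TopologicalSpace E] [PolishSpace E]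
    [MeasurableSpace E] [BorelSpace E] [Nonempty E]
    (m : MeasurableSpace Ω) {m0 : MeasurableSpace Ω} (hm : m ≤ m0) (μ : Measure Ω)
    [IsFiniteMeasure μ] (X : Ω → E) (hX : Measurable X) :
    ∃ Γ : Ω → Set E, IsCondSupport m μ X Γ := by
  have hid : @Measurable Ω Ω m0 m id := measurable_id'' hm
  set κ : @Kernel Ω E m _ := @condDistrib Ω Ω E _ _ _ m0 m X id μ _ with hκ
  have key : ∀ (A : Set Ω) (U : Set E), MeasurableSet[m] A → MeasurableSet U →
      ∫⁻ ω in A, κ ω U ∂μ = μ (A ∩ X ⁻¹' U) := by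
    intro A U hA hU
    exact @setLIntegral_preimage_condDistrib Ω Ω E _ _ _ m0 μ _ id X m U A hid
      hX.aemeasurable hU hA
  have hmeas : ∀ U : Set E, MeasurableSet U → Measurable[m] fun ω => κ ω U :=
    fun U hU => @Kernel.measurable_coe Ω E m _ κ U hU
  have hpos : ∀ (ω : Ω) (U : Set E), IsOpen U →
      (((κ ω).support ∩ U).Nonempty ↔ κ ω U ≠ 0) := by
    intro ω U hU
    constructor
    · rintro ⟨x, hx, hxU⟩
      exact (((κ ω).mem_support_iff_forall x).1 hx U (hU.mem_nhds hxU)).ne'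
    · intro h
      rw [Set.inter_comm]
      exact Measure.nonempty_inter_support_of_pos (pos_iff_ne_zero.2 h)
  refine ⟨fun ω => (κ ω).support, ⟨fun ω => Measure.isClosed_support, ?_⟩, ?_, ?_⟩
  · intro U hU
    simp only [hpos _ U hU]
    exact hmeas U hU.measurableSet (measurableSet_singleton 0).compl
  · have hB := TopologicalSpace.isBasis_countableBasis E
    have hcount := TopologicalSpace.countable_countableBasis E
    have h1 : ∀ U ∈ TopologicalSpace.countableBasis E,
        ∀ᵐ ω ∂μ, κ ω U = 0 → X ω ∉ U := by
      intro U hU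
      have hUm := (hB.isOpen hU).measurableSet
      have hA : MeasurableSet[m] {ω | κ ω U = 0} := hmeas U hUm (measurableSet_singleton 0)
      have h := key _ U hA hUm
      rw [setLIntegral_congr_fun (g := fun _ => 0) (hm _ hA) (fun ω hω => hω)] at h
      rw [ae_iff]
      simp only [lintegral_zero] at h
      refine measure_mono_null ?_ h.symm
      intro ω hω
      simpa using hω
    filter_upwards [(ae_ball_iff hcount).2 h1] with ω hω
    by_contra hx
    rw [Measure.notMem_support_iff_exists] at hx
    obtain ⟨V, hV, hV0⟩ := hx
    obtain ⟨U, hU, hxU, hUV⟩ := hB.mem_nhds_iff.1 hV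
    exact hω U hU (measure_mono_null hUV hV0) hxU
  · intro Γ' hΓ' hXΓ'
    have hB := TopologicalSpace.isBasis_countableBasis E
    have hcount := TopologicalSpace.countable_countableBasis E
    have h1 : ∀ U ∈ TopologicalSpace.countableBasis E,
        ∀ᵐ ω ∂μ, ¬ (Γ' ω ∩ U).Nonempty → κ ω U = 0 := by
      intro U hU
      have hUm := (hB.isOpen hU).measurableSet
      have hA : MeasurableSet[m] {ω | ¬ (Γ' ω ∩ U).Nonempty} :=
        (hΓ'.measurable U (hB.isOpen hU)).compl
      have h := key _ U hA hUm
      have h0 : μ ({ω | ¬ (Γ' ω ∩ U).Nonempty} ∩ X ⁻¹' U) = 0 := by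
        refine measure_mono_null ?_ (ae_iff.1 hXΓ')
        rintro ω ⟨hω, hωU⟩ hmem
        exact hω ⟨X ω, hmem, hωU⟩
      rw [h0, lintegral_eq_zero_iff ((hmeas U hUm).mono hm le_rfl)] at h
      exact (ae_restrict_iff' (hm _ hA)).1 h
    filter_upwards [(ae_ball_iff hcount).2 h1] with ω hω x hx
    by_contra hxn
    obtain ⟨U, hU, hxU, hUV⟩ :=
      hB.mem_nhds_iff.1 ((hΓ'.isClosed ω).isOpen_compl.mem_nhds hxn)
    have h0 := hω U hU (fun ⟨y, hy, hyU⟩ => hUV hyU hy)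
    exact ((κ ω).mem_support_iff_forall x |>.1 hx U ((hB.isOpen hU).mem_nhds hxU)).ne' h0

open Classical in
/-- The `m`-conditional support of `X`, i.e. the smallest closed `m`-measurable random set
containing `X` almost surely (a fixed version of it; it is unique up to null sets). It exists
for every random vector, by `exists_isCondSupport`; the value `univ` is a placeholder for
arguments without conditional support. -/
def condSupport {Ω E : Type*} [TopologicalSpace E] (m : MeasurableSpace Ω)
    {m0 : MeasurableSpace Ω} (μ : Measure Ω) (X : Ω → E) : Ω → Set E :=
  if h : ∃ Γ : Ω → Set E, IsCondSupport m μ X Γ then h.choose else fun _ => Set.univ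

/-- `condSupport` has the defining property of the conditional support. -/
theorem isCondSupport_condSupport {Ω E : Type*} [TopologicalSpace E] [PolishSpace E]
    [MeasurableSpace E] [BorelSpace E] [Nonempty E]
    (m : MeasurableSpace Ω) {m0 : MeasurableSpace Ω} (hm : m ≤ m0) (μ : Measure Ω)
    [IsFiniteMeasure μ] (X : Ω → E) (hX : Measurable X) :
    IsCondSupport m μ X (condSupport m μ X) := by
  have h := exists_isCondSupport m hm μ X hX
  rw [condSupport, dif_pos h]
  exact h.choose_spec

/-! ### The market model on the time interval `[0, T]` -/

/-- Stopping times with values in `[0, T]`. -/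
def IsStopping {Ω : Type*} {m0 : MeasurableSpace Ω} {T : ℝ}
    (𝓕 : Filtration (Set.Icc (0 : ℝ) T) m0) (τ : Ω → Set.Icc (0 : ℝ) T) : Prop :=
  IsStoppingTime 𝓕 (fun ω => (τ ω : WithTop (Set.Icc (0 : ℝ) T)))

/-- The σ-algebra `𝓕_τ` of a `[0, T]`-valued stopping time `τ`. -/
abbrev sigmaAt {Ω : Type*} {m0 : MeasurableSpace Ω} {T : ℝ}
    {𝓕 : Filtration (Set.Icc (0 : ℝ) T) m0} {τ : Ω → Set.Icc (0 : ℝ) T}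
    (hτ : IsStopping 𝓕 τ) : MeasurableSpace Ω :=
  IsStoppingTime.measurableSpace hτ

/-- The terminal values of the discrete-time portfolios started at time `t` with zero initial
capital and revised at finitely many stopping times `t = τ₀ ≤ τ₁ ≤ ⋯ ≤ τₙ = T`:
all sums `∑_{i=1}^n θ_{τ_{i-1}} · (S_{τ_i} - S_{τ_{i-1}})` with `θ_{τ_i}` an
`𝓕_{τ_i}`-measurable random vector. (The values of `τ i` and `θ i` for `i > n` play no role.) -/
def portfolios {Ω : Type*} {m0 : MeasurableSpace Ω} {T : ℝ} {d : ℕ}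
    (𝓕 : Filtration (Set.Icc (0 : ℝ) T) m0)
    (S : Set.Icc (0 : ℝ) T → Ω → EuclideanSpace ℝ (Fin d)) (t : Set.Icc (0 : ℝ) T) :
    Set (Ω → ℝ) :=
  {V | ∃ (n : ℕ) (τ : ℕ → Ω → Set.Icc (0 : ℝ) T) (hτ : ∀ i, IsStopping 𝓕 (τ i))
      (θ : ℕ → Ω → EuclideanSpace ℝ (Fin d)),
    1 ≤ n ∧ (∀ ω, τ 0 ω = t) ∧ (∀ i ω, τ i ω ≤ τ (i + 1) ω) ∧ (∀ ω, (τ n ω : ℝ) = T) ∧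
    (∀ i, Measurable[sigmaAt (hτ i)] (θ i)) ∧
    V = fun ω => ∑ i ∈ Finset.range n,
      inner ℝ (θ i ω) (S (τ (i + 1) ω) ω - S (τ i ω) ω)}

/-- The super-hedging prices at time `t` of the claim `h`: the `𝓕_t`-measurable `p`
such that `p + V ≥ h` almost surely for some discrete-time portfolio `V` started at `t`. -/
def prices {Ω : Type*} {m0 : MeasurableSpace Ω} {T : ℝ} {d : ℕ}
    (𝓕 : Filtration (Set.Icc (0 : ℝ) T) m0) (μ : Measure Ω)
    (S : Set.Icc (0 : ℝ) T → Ω → EuclideanSpace ℝ (Fin d)) (t : Set.Icc (0 : ℝ) T)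
    (h : Ω → ℝ) : Set (Ω → ℝ) :=
  {p | Measurable[𝓕 t] p ∧ ∃ V ∈ portfolios 𝓕 S t, ∀ᵐ ω ∂μ, h ω ≤ p ω + V ω}

/-- Absence of instantaneous profit at time `t`: modulo almost sure equality, the only
nonpositive super-hedging price of the zero claim at time `t` is `0`. -/
def AIPAt {Ω : Type*} {m0 : MeasurableSpace Ω} {T : ℝ} {d : ℕ}
    (𝓕 : Filtration (Set.Icc (0 : ℝ) T) m0) (μ : Measure Ω)
    (S : Set.Icc (0 : ℝ) T → Ω → EuclideanSpace ℝ (Fin d)) (t : Set.Icc (0 : ℝ) T) : Prop :=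
  ∀ p : Ω → ℝ, Measurable[𝓕 t] p →
    ((p ∈ prices 𝓕 μ S t (fun _ => 0) ∧ ∀ᵐ ω ∂μ, p ω ≤ 0) ↔ ∀ᵐ ω ∂μ, p ω = 0)

/-- Absence of instantaneous profit (in discrete time): it holds at every time `t ≤ T`. -/
def AIP {Ω : Type*} {m0 : MeasurableSpace Ω} {T : ℝ} {d : ℕ}
    (𝓕 : Filtration (Set.Icc (0 : ℝ) T) m0) (μ : Measure Ω)
    (S : Set.Icc (0 : ℝ) T → Ω → EuclideanSpace ℝ (Fin d)) : Prop :=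
  ∀ t : Set.Icc (0 : ℝ) T, AIPAt 𝓕 μ S t

end AIPModel

end

/-! Hull condition implies AIP: let `p` plus a portfolio be nonnegative. Given the information at
the start of the last period, this says that the final price lies in a known closed half-space. That
half-space then contains the conditional support, its closed convex hull, and so the price at the
start of the period, where the last gain is zero. Hence the last period can be deleted, and
induction leaves `0 ≤ p` (`ae_nonneg_of_mem_prices`).

AIP implies hull condition: if S at τ₁ is outside the hull, a hyperplane with rational data (q, r)
separates them, and τ₁ < τ₂. By right-continuity q · S_s < r still holds at some s in a countable
dense set with τ₁ < s < τ₂. Buying q at s and holding until τ₂ is then an instantaneous profit on an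
event of `𝓕 s`. AIP at the deterministic time s makes each such event null, and there are only
countably many triples (q, r, s). -/

namespace AIPModel

/-! ### Values of a right-continuous process at stopping times -/

/-- The point `min s (k / (n + 1))` of the interval `[0, T]`. -/
noncomputable def gridPoint {T : ℝ} (s : Set.Icc (0 : ℝ) T) (n k : ℕ) : Set.Icc (0 : ℝ) T :=
  ⟨min s ((k : ℝ) / (n + 1)), le_min s.2.1 (by positivity), (min_le_left _ _).trans s.2.2⟩

theorem gridPoint_le {T : ℝ} (s : Set.Icc (0 : ℝ) T) (n k : ℕ) : gridPoint s n k ≤ s :=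
  Subtype.coe_le_coe.1 (min_le_left _ _)

theorem tendsto_gridPoint {T : ℝ} {s x : Set.Icc (0 : ℝ) T} (hx : x ≤ s) :
    Filter.Tendsto (fun n : ℕ => gridPoint s n (⌊((n : ℝ) + 1) * x⌋₊ + 1)) Filter.atTop
      (nhdsWithin x (Set.Ici x)) := by
  have hxs : (x : ℝ) ≤ s := hx
  have hlow : ∀ n : ℕ, (x : ℝ) ≤ ((⌊((n : ℝ) + 1) * x⌋₊ + 1 : ℕ) : ℝ) / (n + 1) := by
    intro n
    rw [le_div_iff₀ (by positivity)]
    push_cast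
    linarith [Nat.lt_floor_add_one (((n : ℝ) + 1) * x)]
  have hup : ∀ n : ℕ, ((⌊((n : ℝ) + 1) * x⌋₊ + 1 : ℕ) : ℝ) / (n + 1) ≤ x + 1 / ((n : ℝ) + 1) := by
    intro n
    have hn : (0 : ℝ) < n + 1 := by positivity
    have h0 : (0 : ℝ) ≤ ((n : ℝ) + 1) * x := mul_nonneg hn.le x.2.1
    have h1 : ((x : ℝ) + 1 / ((n : ℝ) + 1)) * ((n : ℝ) + 1) = ((n : ℝ) + 1) * x + 1 := by
      field_simp
    rw [div_le_iff₀ hn, h1]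
    push_cast
    linarith [Nat.floor_le h0]
  refine tendsto_nhdsWithin_iff.2 ⟨?_, Filter.Eventually.of_forall fun n => ?_⟩
  · rw [tendsto_subtype_rng]
    refine tendsto_of_tendsto_of_tendsto_of_le_of_le tendsto_const_nhds
      (h := fun n : ℕ => (x : ℝ) + 1 / ((n : ℝ) + 1)) ?_ (fun n => le_min hxs (hlow n))
      (fun n => (min_le_right _ _).trans (hup n))
    simpa using tendsto_const_nhds.add (tendsto_one_div_add_atTop_nhds_zero_nat (𝕜 := ℝ))
  · exact (le_min hxs (hlow n) : (x : ℝ) ≤ _)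

section StoppedValue

variable {Ω E : Type*} {m0 : MeasurableSpace Ω} {T : ℝ}
  {𝓕 : Filtration (Set.Icc (0 : ℝ) T) m0} {S : Set.Icc (0 : ℝ) T → Ω → E}
  [TopologicalSpace E] [TopologicalSpace.PseudoMetrizableSpace E] [MeasurableSpace E]
  [BorelSpace E]

/-- Right-continuity gives the value as a limit along grid times decreasing to `σ` up to the mesh.
Capping the grid at `s` keeps every approximation `𝓕 s`-measurable. -/
theorem measurable_process_comp {s : Set.Icc (0 : ℝ) T} {σ : Ω → Set.Icc (0 : ℝ) T}
    (hS_adapted : ∀ t, Measurable[𝓕 t] (S t))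
    (hS_rightCont : ∀ ω t, ContinuousWithinAt (fun s => S s ω) (Set.Ici t) t)
    (hσ : Measurable[𝓕 s] σ) (hσs : ∀ ω, σ ω ≤ s) :
    Measurable[𝓕 s] fun ω => S (σ ω) ω := by
  refine @measurable_of_tendsto_metrizable Ω E (𝓕 s) _ _ _ _
    (fun n ω => S (gridPoint s n (⌊((n : ℝ) + 1) * σ ω⌋₊ + 1)) ω) _ (fun n => ?_) ?_
  · let : MeasurableSpace Ω := 𝓕 s
    have hpair : Measurable fun z : ℕ × Ω => S (gridPoint s n z.1) z.2 :=
      measurable_from_prod_countable_right fun k =>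
        (hS_adapted (gridPoint s n k)).mono (𝓕.mono (gridPoint_le s n k)) le_rfl
    have hk : Measurable fun ω => ⌊((n : ℝ) + 1) * σ ω⌋₊ + 1 :=
      (Nat.measurable_floor.comp ((measurable_subtype_coe.comp hσ).const_mul _)).add_const 1
    exact hpair.comp (hk.prodMk measurable_id)
  · exact tendsto_pi_nhds.2 fun ω => (hS_rightCont ω (σ ω)).tendsto.comp
      (tendsto_gridPoint (hσs ω))

theorem IsStopping.measurableSet_le {τ : Ω → Set.Icc (0 : ℝ) T} (hτ : IsStopping 𝓕 τ)
    (i : Set.Icc (0 : ℝ) T) : MeasurableSet[𝓕 i] {ω | τ ω ≤ i} := by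
  simpa [IsStopping, WithTop.coe_le_coe] using IsStoppingTime.measurableSet_le hτ i

theorem IsStopping.measurableSet_ge {τ : Ω → Set.Icc (0 : ℝ) T} (hτ : IsStopping 𝓕 τ)
    (i : Set.Icc (0 : ℝ) T) : MeasurableSet[𝓕 i] {ω | i ≤ τ ω} := by
  simpa [IsStopping, WithTop.coe_le_coe] using IsStoppingTime.measurableSet_ge hτ i

theorem IsStopping.measurableSet_inter_le {τ : Ω → Set.Icc (0 : ℝ) T} (hτ : IsStopping 𝓕 τ)
    {A : Set Ω} (hA : MeasurableSet[sigmaAt hτ] A) (i : Set.Icc (0 : ℝ) T) :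
    MeasurableSet[𝓕 i] (A ∩ {ω | τ ω ≤ i}) := by
  simpa [WithTop.coe_le_coe] using hA.2 i

theorem isStopping_const (t : Set.Icc (0 : ℝ) T) : IsStopping 𝓕 (fun _ => t) :=
  isStoppingTime_const 𝓕 t

theorem IsStopping.max_const {τ : Ω → Set.Icc (0 : ℝ) T} (hτ : IsStopping 𝓕 τ)
    (t : Set.Icc (0 : ℝ) T) : IsStopping 𝓕 (fun ω => max (τ ω) t) := by
  simpa [IsStopping, WithTop.coe_max] using IsStoppingTime.max_const hτ t

theorem sigmaAt_mono {τ σ : Ω → Set.Icc (0 : ℝ) T} (hτ : IsStopping 𝓕 τ) (hσ : IsStopping 𝓕 σ)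
    (h : ∀ ω, τ ω ≤ σ ω) : sigmaAt hτ ≤ sigmaAt hσ :=
  IsStoppingTime.measurableSpace_mono hτ hσ fun ω => WithTop.coe_le_coe.2 (h ω)

theorem le_sigmaAt {τ : Ω → Set.Icc (0 : ℝ) T} (hτ : IsStopping 𝓕 τ) {t : Set.Icc (0 : ℝ) T}
    (h : ∀ ω, t ≤ τ ω) : 𝓕 t ≤ sigmaAt hτ :=
  IsStoppingTime.le_measurableSpace_of_const_le hτ fun ω => WithTop.coe_le_coe.2 (h ω)

theorem sigmaAt_le {τ : Ω → Set.Icc (0 : ℝ) T} (hτ : IsStopping 𝓕 τ) : sigmaAt hτ ≤ m0 :=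
  IsStoppingTime.measurableSpace_le hτ

theorem measurable_min_stopping {τ : Ω → Set.Icc (0 : ℝ) T} (hτ : IsStopping 𝓕 τ)
    (i : Set.Icc (0 : ℝ) T) : Measurable[𝓕 i] fun ω => min (τ ω) i := by
  refine @measurable_of_Iic (Set.Icc (0 : ℝ) T) Ω _ _ _ (𝓕 i) _ _ _ _ fun a => ?_
  rcases le_total i a with hia | hai
  · have : (fun ω => min (τ ω) i) ⁻¹' Set.Iic a = Set.univ :=
      Set.eq_univ_of_forall fun ω => (min_le_right _ _).trans hia
    rw [this]
    exact MeasurableSet.univ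
  · have : (fun ω => min (τ ω) i) ⁻¹' Set.Iic a = {ω | τ ω ≤ a} ∪ {_ω | i ≤ a} := by
      ext ω
      simp
    rw [this]
    exact (𝓕.mono hai _ (hτ.measurableSet_le a)).union (MeasurableSet.const _)

theorem measurable_stopped {τ : Ω → Set.Icc (0 : ℝ) T}
    (hS_adapted : ∀ t, Measurable[𝓕 t] (S t))
    (hS_rightCont : ∀ ω t, ContinuousWithinAt (fun s => S s ω) (Set.Ici t) t)
    (hτ : IsStopping 𝓕 τ) : Measurable[sigmaAt hτ] fun ω => S (τ ω) ω := by
  intro B hB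
  have key : ∀ i : Set.Icc (0 : ℝ) T,
      MeasurableSet[𝓕 i] ((fun ω => S (τ ω) ω) ⁻¹' B ∩ {ω | τ ω ≤ i}) := by
    intro i
    have h := measurable_process_comp hS_adapted hS_rightCont (measurable_min_stopping hτ i)
      (fun ω => min_le_right _ _) hB
    have heq : (fun ω => S (τ ω) ω) ⁻¹' B ∩ {ω | τ ω ≤ i} =
        (fun ω => S (min (τ ω) i) ω) ⁻¹' B ∩ {ω | τ ω ≤ i} := by
      ext ω
      simp only [Set.mem_inter_iff, Set.mem_preimage, Set.mem_ofPred_eq, and_congr_left_iff]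
      intro hω
      rw [min_eq_left hω]
    rw [heq]
    exact h.inter (hτ.measurableSet_le i)
  refine ⟨?_, fun i => by simpa [WithTop.coe_le_coe] using key i⟩
  -- Membership in `⨆ t, 𝓕 t` comes from `key` at the final time, where `τ ≤ T` is no restriction; a
  -- sample point is needed to know that `0 ≤ T`.
  rcases isEmpty_or_nonempty Ω with hΩ | ⟨⟨ω₀⟩⟩
  · exact (Set.eq_empty_of_isEmpty ((fun ω => S (τ ω) ω) ⁻¹' B)) ▸ @MeasurableSet.empty Ω (⨆ t, 𝓕 t)
  · have hT : (0 : ℝ) ≤ T := (τ ω₀).2.1.trans (τ ω₀).2.2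
    have h := key ⟨T, hT, le_rfl⟩
    have huniv : {ω | τ ω ≤ (⟨T, hT, le_rfl⟩ : Set.Icc (0 : ℝ) T)} = Set.univ :=
      Set.eq_univ_of_forall fun ω => (τ ω).2.2
    rw [huniv, Set.inter_univ] at h
    exact le_iSup (fun t => (𝓕 t : MeasurableSpace Ω)) _ _ h

end StoppedValue

/-! ### Half-spaces and separation -/

/-- A half-space whose parameters depend measurably on `ω` is a closed random set. -/
theorem isClosedRandomSet_halfSpace {Ω E : Type*} [NormedAddCommGroup E]
    [InnerProductSpace ℝ E] [SecondCountableTopology E] [MeasurableSpace E] [BorelSpace E]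
    (m : MeasurableSpace Ω) {Y : Ω → ℝ} {θ X : Ω → E} (hY : Measurable Y) (hθ : Measurable θ)
    (hX : Measurable X) :
    IsClosedRandomSet m fun ω => {x | 0 ≤ Y ω + inner ℝ (θ ω) (x - X ω)} := by
  refine ⟨fun ω => isClosed_le continuous_const (by fun_prop), fun U hU => ?_⟩
  have heq : {ω | ({x | 0 ≤ Y ω + inner ℝ (θ ω) (x - X ω)} ∩ U).Nonempty} =
      ⋃ x ∈ TopologicalSpace.denseSeq E '' (TopologicalSpace.denseSeq E ⁻¹' U),
        {ω | 0 ≤ Y ω + inner ℝ (θ ω) (x - X ω)} := by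
    ext ω
    simp only [Set.mem_iUnion, Set.mem_ofPred_eq, exists_prop]
    constructor
    · rintro ⟨x, hx, hxU⟩
      have hx' : 0 ≤ Y ω + inner ℝ (θ ω) (x - X ω) := hx
      -- If `θ ω = 0`, the half-space is the whole space. Otherwise a small push along `θ ω` moves
      -- `x` into the open half-space, where a dense point can be chosen.
      by_cases h0 : θ ω = 0
      · obtain ⟨n, hn⟩ := (TopologicalSpace.denseRange_denseSeq E).exists_mem_open hU ⟨x, hxU⟩
        exact ⟨_, ⟨n, hn, rfl⟩, by simpa [h0] using hx'⟩
      · have hopen : IsOpen (U ∩ {y | 0 < Y ω + inner ℝ (θ ω) (y - X ω)}) :=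
          hU.inter (isOpen_lt continuous_const (by fun_prop))
        have hmove : Filter.Tendsto (fun ε : ℝ => x + ε • θ ω) (nhdsWithin 0 (Set.Ioi 0))
            (nhds x) := by
          have : Continuous fun ε : ℝ => x + ε • θ ω := by fun_prop
          simpa using (this.tendsto 0).mono_left nhdsWithin_le_nhds
        obtain ⟨ε, hεU, hε⟩ :=
          ((hmove.eventually (hU.mem_nhds hxU)).and self_mem_nhdsWithin).exists
        have hpos : 0 < Y ω + inner ℝ (θ ω) (x + ε • θ ω - X ω) := by
          have h1 : x + ε • θ ω - X ω = (x - X ω) + ε • θ ω := by abel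
          rw [h1, inner_add_right, inner_smul_right]
          have := mul_pos (Set.mem_Ioi.1 hε) (real_inner_self_pos.2 h0)
          linarith
        obtain ⟨n, hnU, hn⟩ := (TopologicalSpace.denseRange_denseSeq E).exists_mem_open hopen
          ⟨_, hεU, hpos⟩
        exact ⟨_, ⟨n, hnU, rfl⟩, le_of_lt hn⟩
    · rintro ⟨x, ⟨n, hn, rfl⟩, hx⟩
      exact ⟨_, hx, hn⟩
  rw [heq]
  refine MeasurableSet.biUnion ((Set.to_countable _).image _) fun x _ => ?_
  exact measurableSet_le measurable_const (hY.add (hθ.inner (measurable_const.sub hX)))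

theorem convex_halfSpace_inner {E : Type*} [NormedAddCommGroup E] [InnerProductSpace ℝ E]
    (c : ℝ) (θ z : E) : Convex ℝ {x | 0 ≤ c + inner ℝ θ (x - z)} := by
  have : {x | 0 ≤ c + inner ℝ θ (x - z)} = {x | inner ℝ θ z - c ≤ inner ℝ θ x} := by
    ext x
    simp only [Set.mem_ofPred_eq, inner_sub_right]
    constructor <;> intro h <;> linarith
  rw [this]
  exact convex_halfSpace_ge (innerₛₗ ℝ θ).isLinear _

/-- The vector with the given rational coordinates. -/
def ratVec {d : ℕ} (q : Fin d → ℚ) : EuclideanSpace ℝ (Fin d) :=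
  WithLp.toLp 2 fun i => (q i : ℝ)

/-- In the nonnegative orthant, a point outside a closed convex hull can be separated from it by
a hyperplane with rational coefficients. -/
theorem exists_rat_separation {d : ℕ} {C : Set (EuclideanSpace ℝ (Fin d))}
    {x : EuclideanSpace ℝ (Fin d)} (hC : ∀ y ∈ C, ∀ i, 0 ≤ y i) (hx0 : ∀ i, 0 ≤ x i)
    (hx : x ∉ closedConvexHull ℝ C) :
    ∃ (q : Fin d → ℚ) (r : ℚ), inner ℝ (ratVec q) x < r ∧
      ∀ y ∈ C, (r : ℝ) ≤ inner ℝ (ratVec q) y := by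
  obtain ⟨f, u, hfx, hf⟩ := geometric_hahn_banach_point_closed (convex_closedConvexHull (𝕜 := ℝ))
    isClosed_closedConvexHull hx
  set v := (InnerProductSpace.toDual ℝ (EuclideanSpace ℝ (Fin d))).symm f with hv
  have hvf : ∀ y, f y = ∑ i, v i * y i := by
    intro y
    rw [← InnerProductSpace.toDual_symm_apply (𝕜 := ℝ) (x := y) (y := f), PiLp.inner_apply]
    simp [hv, mul_comm]
  have hq : ∀ (q : Fin d → ℚ) y, inner ℝ (ratVec q) y = ∑ i, (q i : ℝ) * y i := by
    intro q y
    rw [PiLp.inner_apply]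
    simp [ratVec, mul_comm]
  have hs : 0 ≤ ∑ i, x i := Finset.sum_nonneg fun i _ => hx0 i
  set ε := (u - f x) / (∑ i, x i + 1) with hε
  have hε0 : 0 < ε := div_pos (by linarith) (by linarith)
  have hεs : ε * ∑ i, x i < u - f x := by
    have : ε * (∑ i, x i + 1) = u - f x := div_mul_cancel₀ _ (by linarith)
    linarith
  -- Rounding every coordinate upwards can only raise the functional on the orthant, so the bound on
  -- the possibly unbounded `C` survives; at `x` the increase is at most `ε * ∑ i, x i`, less than
  -- the gap.
  choose q hq1 hq2 using fun i => exists_rat_btwn (lt_add_of_pos_right (v i) hε0)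
  have hqx : inner ℝ (ratVec q) x < u := by
    have : inner ℝ (ratVec q) x ≤ f x + ε * ∑ i, x i := by
      rw [hq, hvf, Finset.mul_sum, ← Finset.sum_add_distrib]
      refine Finset.sum_le_sum fun i _ => ?_
      rw [← add_mul]
      exact mul_le_mul_of_nonneg_right (hq2 i).le (hx0 i)
    linarith
  obtain ⟨r, hr1, hr2⟩ := exists_rat_btwn hqx
  refine ⟨q, r, hr1, fun y hy => hr2.le.trans ((hf y (subset_closedConvexHull hy)).le.trans ?_)⟩
  rw [hq, hvf]
  exact Finset.sum_le_sum fun i _ => mul_le_mul_of_nonneg_right (hq1 i).le (hC y hy i)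

/-! ### The market -/

section Market

variable {Ω : Type*} {m0 : MeasurableSpace Ω} {μ : Measure Ω} {T : ℝ}
  {d : ℕ} {𝓕 : Filtration (Set.Icc (0 : ℝ) T) m0}
  {S : Set.Icc (0 : ℝ) T → Ω → EuclideanSpace ℝ (Fin d)}

/-! ### From the hull condition to AIP -/

/-- If `X` lies in the closed convex hull of the conditional support of `Z`, then a portfolio over
one period from `X` to `Z` superhedges zero only at nonnegative prices. -/
theorem ae_nonneg_of_mem_closedConvexHull [IsFiniteMeasure μ] {m : MeasurableSpace Ω} (hm : m ≤ m0) {Y : Ω → ℝ}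
    {θ X Z : Ω → EuclideanSpace ℝ (Fin d)} (hY : Measurable[m] Y) (hθ : Measurable[m] θ)
    (hX : Measurable[m] X) (hZ : Measurable[m0] Z)
    (hmem : ∀ᵐ ω ∂μ, X ω ∈ closedConvexHull ℝ (condSupport m μ Z ω))
    (h : ∀ᵐ ω ∂μ, 0 ≤ Y ω + inner ℝ (θ ω) (Z ω - X ω)) : ∀ᵐ ω ∂μ, 0 ≤ Y ω := by
  have hR := isClosedRandomSet_halfSpace m hY hθ hX
  filter_upwards [hmem, (isCondSupport_condSupport m hm μ Z hZ).ae_subset _ hR h] with ω h1 h2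
  have h3 : X ω ∈ {x | 0 ≤ Y ω + inner ℝ (θ ω) (x - X ω)} :=
    closedConvexHull_min h2 (convex_halfSpace_inner _ _ _) (hR.isClosed ω) h1
  simpa using h3

theorem ae_nonneg_of_mem_prices [IsFiniteMeasure μ]
    (hS_adapted : ∀ t, Measurable[𝓕 t] (S t))
    (hS_rightCont : ∀ ω t, ContinuousWithinAt (fun s => S s ω) (Set.Ici t) t)
    (hmem : ∀ (τ₁ τ₂ : Ω → Set.Icc (0 : ℝ) T) (h₁ : IsStopping 𝓕 τ₁)
        (_h₂ : IsStopping 𝓕 τ₂), (∀ ω, τ₁ ω ≤ τ₂ ω) →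
        ∀ᵐ ω ∂μ, S (τ₁ ω) ω ∈ closedConvexHull ℝ
          (condSupport (sigmaAt h₁) μ (fun ω' => S (τ₂ ω') ω') ω))
    {t : Set.Icc (0 : ℝ) T} {p : Ω → ℝ} (hp : p ∈ prices 𝓕 μ S t fun _ => 0) :
    ∀ᵐ ω ∂μ, 0 ≤ p ω := by
  -- The conditions `1 ≤ n` and τₙ = T are discarded, since deleting the last period need not
  -- preserve them.
  obtain ⟨hpm, V, ⟨n, τ, hτ, θ, -, hτ0, hτmono, -, hθ, rfl⟩, hV⟩ := hp
  have hmono : ∀ {i j : ℕ}, i ≤ j → ∀ ω, τ i ω ≤ τ j ω := fun hij ω =>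
    monotone_nat_of_le_succ (f := fun i => τ i ω) (fun i => hτmono i ω) hij
  have hSm : ∀ i, Measurable[sigmaAt (hτ i)] fun ω => S (τ i ω) ω := fun i =>
    measurable_stopped hS_adapted hS_rightCont (hτ i)
  induction n with
  | zero => simpa using hV
  | succ k ih =>
    refine ih (ae_nonneg_of_mem_closedConvexHull (sigmaAt_le (hτ k)) ?_ (hθ k) (hSm k)
      ((hSm (k + 1)).mono (sigmaAt_le _) le_rfl)
      (hmem _ _ (hτ k) (hτ (k + 1)) (hmono k.le_succ)) ?_)
    · refine (hpm.mono (le_sigmaAt (hτ k) fun ω => (hτ0 ω).symm.le.trans (hmono k.zero_le ω))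
        le_rfl).add (Finset.measurable_fun_sum _ fun i hi => ?_)
      have hik : i + 1 ≤ k := Finset.mem_range.1 hi
      have h1 := (hθ i).mono (sigmaAt_mono (hτ i) (hτ k) (hmono (i.le_succ.trans hik))) le_rfl
      have h2 := (hSm i).mono (sigmaAt_mono (hτ i) (hτ k) (hmono (i.le_succ.trans hik))) le_rfl
      have h3 := (hSm (i + 1)).mono (sigmaAt_mono (hτ (i + 1)) (hτ k) (hmono hik)) le_rfl
      exact h1.inner (h3.sub h2)
    · filter_upwards [hV] with ω hω
      rw [Finset.sum_range_succ] at hω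
      linarith

theorem mem_prices_zero_of_ae_eq_zero {t : Set.Icc (0 : ℝ) T} {p : Ω → ℝ}
    (hpm : Measurable[𝓕 t] p) (hp : ∀ᵐ ω ∂μ, p ω = 0) : p ∈ prices 𝓕 μ S t fun _ => 0 := by
  have hT : (0 : ℝ) ≤ T := t.2.1.trans t.2.2
  refine ⟨hpm, _, ⟨1, fun i _ => if i = 0 then t else ⟨T, hT, le_rfl⟩,
    fun i => isStopping_const _, fun _ _ => 0, le_rfl, fun _ => rfl, ?_, ?_,
    fun i => measurable_const, rfl⟩, ?_⟩
  · intro i ω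
    rcases i with _ | i
    · exact Subtype.coe_le_coe.1 t.2.2
    · exact le_rfl
  · simp
  · filter_upwards [hp] with ω hω
    simp [hω]

/-! ### From AIP to the hull condition -/

/-- The gain from holding, between the times `t` and `σ ≥ t`, a position chosen at time `t`. -/
theorem inner_mem_portfolios {t : Set.Icc (0 : ℝ) T} {σ : Ω → Set.Icc (0 : ℝ) T}
    (hσ : IsStopping 𝓕 σ) (htσ : ∀ ω, t ≤ σ ω) {θ : Ω → EuclideanSpace ℝ (Fin d)}
    (hθ : Measurable[𝓕 t] θ) :
    (fun ω => inner ℝ (θ ω) (S (σ ω) ω - S t ω)) ∈ portfolios 𝓕 S t := by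
  have hT : (0 : ℝ) ≤ T := t.2.1.trans t.2.2
  -- A second period with zero position runs from `σ` to the required final time.
  let τ : ℕ → Ω → Set.Icc (0 : ℝ) T := fun i => match i with
    | 0 => fun _ => t
    | 1 => σ
    | _ + 2 => fun _ => ⟨T, hT, le_rfl⟩
  let η : ℕ → Ω → EuclideanSpace ℝ (Fin d) := fun i => match i with
    | 0 => θ
    | _ + 1 => fun _ => 0
  have hτ : ∀ i, IsStopping 𝓕 (τ i) := fun i => match i with
    | 0 => isStopping_const t
    | 1 => hσ
    | _ + 2 => isStopping_const _
  refine ⟨2, τ, hτ, η, by norm_num, fun _ => rfl, ?_, fun _ => rfl, ?_, ?_⟩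
  · intro i ω
    match i with
    | 0 => exact htσ ω
    | 1 => exact Subtype.coe_le_coe.1 (σ ω).2.2
    | _ + 2 => exact le_rfl
  · intro i
    match i with
    | 0 => exact hθ.mono (le_sigmaAt (hτ 0) fun _ => le_rfl) le_rfl
    | _ + 1 => exact measurable_const
  · funext ω
    simp [Finset.sum_range_succ, τ, η]

/-- Under AIP at time `t`, no event of `𝓕 t` of positive probability offers an instantaneous
profit. -/
theorem AIPAt.measure_eq_zero {t : Set.Icc (0 : ℝ) T} (hAIP : AIPAt 𝓕 μ S t)
    (hS_adapted : ∀ t, Measurable[𝓕 t] (S t)) {σ : Ω → Set.Icc (0 : ℝ) T}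
    (hσ : IsStopping 𝓕 σ) (htσ : ∀ ω, t ≤ σ ω) {B : Set Ω} (hB : MeasurableSet[𝓕 t] B)
    (v : EuclideanSpace ℝ (Fin d)) (r : ℝ) (hlt : ∀ ω ∈ B, inner ℝ v (S t ω) < r)
    (hge : ∀ᵐ ω ∂μ, ω ∈ B → r ≤ inner ℝ v (S (σ ω) ω)) : ∀ᵐ ω ∂μ, ω ∉ B := by
  have hpm : Measurable[𝓕 t] (B.indicator fun ω => inner ℝ v (S t ω) - r) :=
    ((measurable_const.inner (hS_adapted t)).sub measurable_const).indicator hB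
  have hθ : Measurable[𝓕 t] (B.indicator fun _ => v) := measurable_const.indicator hB
  -- On `B`, price plus gain telescopes to ⟨v, S_σ⟩ - r, which is nonnegative although the price is
  -- negative.
  have h0 := (hAIP _ hpm).1 ⟨⟨hpm, _, inner_mem_portfolios hσ htσ hθ, ?_⟩, ?_⟩
  · filter_upwards [h0] with ω hω hωB
    rw [Set.indicator_of_mem hωB] at hω
    linarith [hlt ω hωB]
  · filter_upwards [hge] with ω hω
    by_cases hωB : ω ∈ B
    · simp only [Set.indicator_of_mem hωB, inner_sub_right]
      linarith [hω hωB]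
    · simp [hωB]
  · refine Filter.Eventually.of_forall fun ω => ?_
    by_cases hωB : ω ∈ B
    · rw [Set.indicator_of_mem hωB]
      linarith [hlt ω hωB]
    · simp [hωB]

theorem AIP.ae_mem_closedConvexHull [IsFiniteMeasure μ] (hAIP : AIP 𝓕 μ S)
    (hS_nonneg : ∀ t ω i, 0 ≤ S t ω i)
    (hS_adapted : ∀ t, Measurable[𝓕 t] (S t))
    (hS_rightCont : ∀ ω t, ContinuousWithinAt (fun s => S s ω) (Set.Ici t) t)
    {τ₁ τ₂ : Ω → Set.Icc (0 : ℝ) T} (h₁ : IsStopping 𝓕 τ₁) (h₂ : IsStopping 𝓕 τ₂)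
    (hle : ∀ ω, τ₁ ω ≤ τ₂ ω) :
    ∀ᵐ ω ∂μ, S (τ₁ ω) ω ∈ closedConvexHull ℝ
      (condSupport (sigmaAt h₁) μ (fun ω' => S (τ₂ ω') ω') ω) := by
  have hΓ := isCondSupport_condSupport (sigmaAt h₁) (sigmaAt_le h₁) μ (fun ω => S (τ₂ ω) ω)
    ((measurable_stopped hS_adapted hS_rightCont h₂).mono (sigmaAt_le h₂) le_rfl)
  set Γ := condSupport (sigmaAt h₁) μ (fun ω => S (τ₂ ω) ω)
  -- The constant orthant competes in the minimality of `Γ`; rational separation needs this.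
  have horthant : ∀ᵐ ω ∂μ, Γ ω ⊆ {y | ∀ i, 0 ≤ y i} := by
    refine hΓ.ae_subset (fun _ => {y | ∀ i, 0 ≤ y i}) ⟨fun _ => ?_, fun U _ => ?_⟩ ?_
    · rw [Set.ofPred_forall]
      exact isClosed_iInter fun i => isClosed_le continuous_const (by fun_prop)
    · exact MeasurableSet.const _
    · exact Filter.Eventually.of_forall fun ω => hS_nonneg _ ω
  -- That `Γ` misses the open half-space is known at `τ₁`, hence at `s` where `τ₁ ≤ s`; this puts `B
  -- q r s` in `𝓕 s`.
  let B : (Fin d → ℚ) → ℚ → Set.Icc (0 : ℝ) T → Set Ω := fun q r s =>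
    ({ω | (Γ ω ∩ {x | inner ℝ (ratVec q) x < (r : ℝ)}).Nonempty}ᶜ ∩ {ω | τ₁ ω ≤ s}) ∩
      {ω | s ≤ τ₂ ω} ∩ {ω | inner ℝ (ratVec q) (S s ω) < (r : ℝ)}
  have hnull : ∀ q r s, ∀ᵐ ω ∂μ, ω ∉ B q r s := by
    intro q r s
    have hopen : IsOpen {x : EuclideanSpace ℝ (Fin d) | inner ℝ (ratVec q) x < (r : ℝ)} :=
      isOpen_lt (by fun_prop) continuous_const
    have hB : MeasurableSet[𝓕 s] (B q r s) :=
      ((h₁.measurableSet_inter_le (hΓ.isClosedRandomSet.measurable _ hopen).compl s).inter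
        (h₂.measurableSet_ge s)).inter
        (measurableSet_lt (measurable_const.inner (hS_adapted s)) measurable_const)
    -- The maximum of `τ₂` and `s` is a stopping time after `s` everywhere, equal to `τ₂` on `B q r
    -- s`.
    refine (hAIP s).measure_eq_zero hS_adapted (h₂.max_const s) (fun ω => le_max_right _ _) hB
      (ratVec q) r (fun ω hω => hω.2) ?_
    filter_upwards [hΓ.ae_mem] with ω hω hωB
    rw [max_eq_left hωB.1.2]
    by_contra! hlt
    exact hωB.1.1.1 ⟨_, hω, hlt⟩
  obtain ⟨D, hDc, hD⟩ := TopologicalSpace.exists_countable_dense (Set.Icc (0 : ℝ) T)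
  have hall : ∀ᵐ ω ∂μ, ∀ q r, ∀ s ∈ D, ω ∉ B q r s :=
    ae_all_iff.2 fun q => ae_all_iff.2 fun r => (ae_ball_iff hDc).2 fun s _ => hnull q r s
  filter_upwards [hall, horthant, hΓ.ae_mem] with ω hω horth hmem
  by_contra hnot
  rcases (hle ω).eq_or_lt with heq | hlt
  · exact hnot (heq ▸ subset_closedConvexHull hmem)
  obtain ⟨q, r, hqx, hqC⟩ := exists_rat_separation (fun y hy => horth hy) (hS_nonneg _ ω) hnot
  have hev : ∀ᶠ s in nhdsWithin (τ₁ ω) (Set.Ici (τ₁ ω)),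
      inner ℝ (ratVec q) (S s ω) < (r : ℝ) :=
    (tendsto_const_nhds.inner (hS_rightCont ω (τ₁ ω)).tendsto).eventually_lt_const hqx
  obtain ⟨u, hu, hsub⟩ := (mem_nhdsGE_iff_exists_Ico_subset' hlt).1 hev
  obtain ⟨s, hsD, hs⟩ : ∃ s ∈ D, s ∈ Set.Ioo (τ₁ ω) (min u (τ₂ ω)) := by
    obtain ⟨s, hs, hsD⟩ := hD.exists_between (lt_min hu hlt)
    exact ⟨s, hs, hsD⟩
  refine hω q r s hsD ⟨⟨⟨?_, hs.1.le⟩, (hs.2.trans_le (min_le_right _ _)).le⟩,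
    hsub ⟨hs.1.le, hs.2.trans_le (min_le_left _ _)⟩⟩
  rintro ⟨y, hy, hyr⟩
  exact (hqC y hy).not_gt hyr

end Market

end AIPModel

theorem proposition4p4 {Ω : Type*} {m0 : MeasurableSpace Ω} (μ : Measure Ω)
    [IsProbabilityMeasure μ] {T : ℝ} (hT : 0 < T) {d : ℕ}
    (𝓕 : Filtration (Set.Icc (0 : ℝ) T) m0) [𝓕.IsRightContinuous]
    (hcomplete : ∀ t, ∀ N : Set Ω, μ N = 0 → MeasurableSet[𝓕 t] N)
    (S : Set.Icc (0 : ℝ) T → Ω → EuclideanSpace ℝ (Fin d))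
    (hS_nonneg : ∀ t ω i, 0 ≤ S t ω i)
    (hS_adapted : ∀ t, Measurable[𝓕 t] (S t))
    (hS_rightCont : ∀ ω t, ContinuousWithinAt (fun s => S s ω) (Set.Ici t) t) :
    AIPModel.AIP 𝓕 μ S ↔
      ∀ (τ₁ τ₂ : Ω → Set.Icc (0 : ℝ) T) (h₁ : AIPModel.IsStopping 𝓕 τ₁)
        (_h₂ : AIPModel.IsStopping 𝓕 τ₂), (∀ ω, τ₁ ω ≤ τ₂ ω) →
        ∀ᵐ ω ∂μ, S (τ₁ ω) ω ∈ closedConvexHull ℝ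
          (AIPModel.condSupport (AIPModel.sigmaAt h₁) μ (fun ω' => S (τ₂ ω') ω') ω) := by
  refine ⟨fun hAIP τ₁ τ₂ h₁ h₂ hle =>
    hAIP.ae_mem_closedConvexHull hS_nonneg hS_adapted hS_rightCont h₁ h₂ hle,
    fun hmem t p hpm => ⟨fun ⟨hp, hp0⟩ => ?_, fun hp => ⟨?_, ?_⟩⟩⟩
  · filter_upwards [hp0, AIPModel.ae_nonneg_of_mem_prices hS_adapted hS_rightCont hmem hp]
      with ω h1 h2
    exact le_antisymm h1 h2
  · exact AIPModel.mem_prices_zero_of_ae_eq_zero hpm hp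
  · exact hp.mono fun ω h => h.le
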